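/- Let $B\colon\mathsf{Set}\to\mathsf{Set}$ be a polynomial functor, i.e. a functor isomorphic to one of the form $X\mapsto\coprod_{a\in A}X^{E_a}$ for some family of sets $(E_a)_{a\in A}$. Let $B_0=1$ and $B_{i+1}=BB_i$ for $i<\omega$, with connecting maps $B_{1,0}\colon B_1\to 1$ the unique map and $B_{i+2,i+1}=B(B_{i+1,i})$. Let $B_\omega=\lim_{i<\omega}B_i$ with limit projections $B_{\omega,i}\colon B_\omega\to B_i$, and let $B_{\omega+1,\omega}\colon BB_\omega\to B_\omega$ be the unique map with $B_{\omega,i+1}\circ B_{\omega+1,\omega}=B(B_{\omega,i})$ for all $i<\omega$. Then $B_{\omega+1,\omega}$ is a bijection and, with $\zeta=B_{\omega+1,\omega}^{-1}\colon B_\omega\to BB_\omega$, the pair $(B_\omega,\zeta)$ is a final $B$-coalgebra. Moreover, let $F\colon\mathsf{Set}\to\mathsf{Set}$ be any functor and let $\alpha\colon FB_\omega\to B_\omega$ be a causal algebra, i.e. a map such that for every set $X$, all maps $f,g\colon X\to B_\omega$ and every $i<\omega$, the equation $B_{\omega,i}\circ f=B_{\omega,i}\circ g$ implies $B_{\omega,i}\circ\alpha\circ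 Ff=B_{\omega,i}\circ\alpha\circ Fg$. Then coinduction up to $\alpha$ is valid: for every set $X$ and every map $g\colon X\to BFX$ there exists a unique map $s\colon X\to B_\omega$ such that $\zeta\circ s=B\alpha\circ BFs\circ g$. -/

import Mathlib

open CategoryTheory CategoryTheory.Limits Opposite

universe u v w

namespace CausalUpTo

/-- The functor `X ↦ ∐ a : P.A, X ^ (P.B a)` on `Set` given by a family of sets. -/
def polynomialFunctor (P : PFunctor.{u, u}) : Type u ⥤ Type u where
  obj X := P.Obj X
  map f := TypeCat.ofHom (fun x => P.map f x)

/-- A `Set` endofunctor is polynomial (in one variable) if it is isomorphic to a functor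
`X ↦ ∐ a : A, X ^ (E a)` for some family of sets `E a`. -/
def IsPolynomial (B : Type u ⥤ Type u) : Prop :=
  ∃ P : PFunctor.{u, u}, Nonempty (B ≅ polynomialFunctor P)

section FinalSequence

variable (B : Type u ⥤ Type u)

/-- The finite stages `B₀ = 1`, `Bₙ₊₁ = B Bₙ` of the final sequence. -/
def stage : ℕ → Type u
  | 0 => PUnit
  | n + 1 => B.obj (stage n)

/-- The connecting maps `Bₙ₊₁ ⟶ Bₙ`: the unique map to `1`, and then `B` of the previous one. -/
def conn : (n : ℕ) → (stage B (n + 1) ⟶ stage B n)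
  | 0 => TypeCat.ofHom (fun _ => PUnit.unit)
  | n + 1 => B.map (conn n)

/-- The final sequence of `B` below `ω`, as a functor `ωᵒᵖ ⥤ Set`. -/
def finalSequence : ℕᵒᵖ ⥤ Type u :=
  Functor.ofOpSequence (conn B)

variable {B}

/-- The projection `c.pt ⟶ Bᵢ` of a cone over the final sequence; for a limit cone this is the
map `B_{ω,i} : B_ω ⟶ Bᵢ`. -/
def proj (c : Cone (finalSequence B)) (i : ℕ) : c.pt ⟶ stage B i :=
  c.π.app (op i)

/-- For a cone `c` over the final sequence, the cone with vertex `B c.pt` whose components are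
the map to `1` and the maps `B (c_n) : B c.pt ⟶ B Bₙ = Bₙ₊₁`. -/
def shiftCone (c : Cone (finalSequence B)) : Cone (finalSequence B) where
  pt := B.obj c.pt
  π := NatTrans.ofOpSequence
    (fun n => match n with
      | 0 => TypeCat.ofHom (fun _ => PUnit.unit)
      | n + 1 => B.map (proj c n))
    (fun n => by
      cases n with
      | zero => rfl
      | succ n =>
        have h := c.w (homOfLE (Nat.le_add_right n 1)).op
        have e : ∀ m, (finalSequence B).map (homOfLE (Nat.le_add_right m 1)).op = conn B m :=
          fun m => Functor.ofOpSequence_map_homOfLE_succ (conn B) m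
        rw [e] at h ⊢
        exact (Category.id_comp _).trans ((congrArg B.map h.symm).trans (B.map_comp _ _)))

/-- The connecting map `B_{ω+1,ω} : B B_ω ⟶ B_ω` of the final sequence, where the limit cone `c`
exhibits `c.pt` as `B_ω`. It is the unique map whose composite with `B_{ω,n+1}` is
`B (B_{ω,n})` for every `n`. -/
def connOmega {c : Cone (finalSequence B)} (hc : IsLimit c) : B.obj c.pt ⟶ c.pt :=
  hc.lift (shiftCone c)

end FinalSequence

/-- Causal operations `α : F A_ω ⟶ B_ω`, where the cones `a` and `b` over the final sequences of
`A` and `B` consist of the projections `A_{ω,i} : A_ω ⟶ A_i` and `B_{ω,i} : B_ω ⟶ B_i`. -/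
def IsCausal {A B : Type u ⥤ Type u} (a : Cone (finalSequence A)) (b : Cone (finalSequence B))
    (F : Type u ⥤ Type u) (α : F.obj a.pt ⟶ b.pt) : Prop :=
  ∀ (X : Type u) (f g : X ⟶ a.pt) (i : ℕ),
    f ≫ proj a i = g ≫ proj a i →
      F.map f ≫ α ≫ proj b i = F.map g ≫ α ≫ proj b i

/-- Causal algebras are the causal operations from `B` to `B`. -/
abbrev IsCausalAlgebra {B : Type u ⥤ Type u} (b : Cone (finalSequence B))
    (F : Type u ⥤ Type u) (α : F.obj b.pt ⟶ b.pt) : Prop :=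
  IsCausal b b F α

/-- Validity of coinduction up to an algebra `α : F Z ⟶ Z` on (the carrier of) a coalgebra
`ζ : Z ⟶ B Z`, which is meant to be a final one: every `g : X ⟶ B F X` has a unique solution
`s : X ⟶ Z`, that is, a unique `s` with `ζ ∘ s = B α ∘ B F s ∘ g`. -/
def CoinductionUpToValid {C : Type w} [Category.{v} C] {B : C ⥤ C} (Z : Endofunctor.Coalgebra B)
    (F : C ⥤ C) (α : F.obj Z.V ⟶ Z.V) : Prop :=
  ∀ (X : C) (g : X ⟶ B.obj (F.obj X)),
    ∃! s : X ⟶ Z.V, s ≫ Z.str = g ≫ B.map (F.map s) ≫ B.map α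

end CausalUpTo

/-!
Two facts carry the proof.

A polynomial functor preserves the limit of its final sequence (`bijective_connOmega`): an element
of `∐ a, X ^ (E a)` is a shape `a` together with a family `E a → X`, the connecting maps leave the
shape alone, so a compatible sequence of elements of the `B Bₙ` is one shape together with a
compatible sequence of families `E a → Bₙ`, that is, with one family `E a → B_ω`.

Once `B_{ω+1,ω}` is invertible, a map `s : X ⟶ B_ω` solves the equation given by `g` exactly when
it is a fixed point of the operator `Φ s = B_{ω+1,ω} ∘ B (α ∘ F s) ∘ g`. Causality of `α` says that
`Φ` is contractive (`solutionStep_proj_succ_congr`): the stage `Bᵢ` of `s` determines the stage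
`Bᵢ₊₁` of `Φ s`. As at stage `B₀ = 1` any two maps agree, fixed points are unique, and the
iterates of `Φ` from any map `X ⟶ B_ω` converge to one. The only point that needs care is that there
is some map `X ⟶ B_ω` to begin with (`exists_hom_pt`): when `X` has an element, `F X` maps to `X`,
so `g` yields a coalgebra on `X`, which lies over the final sequence.

Finality of `(B_ω, ζ)` is the instance where `F` is the identity functor and `α` the identity.
-/

namespace CausalUpTo

section FinalSequence

variable {B : Type u ⥤ Type u} {c : Cone (finalSequence B)}

/-! ### Maps into the limit of the final sequence -/

theorem proj_succ_conn (c : Cone (finalSequence B)) (n : ℕ) :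
    proj c (n + 1) ≫ conn B n = proj c n := by
  have h := c.w (homOfLE (Nat.le_add_right n 1)).op
  rwa [show (finalSequence B).map (homOfLE (Nat.le_add_right n 1)).op = conn B n from
    Functor.ofOpSequence_map_homOfLE_succ (conn B) n] at h

theorem eq_of_comp_proj_eq (hc : IsLimit c) {X : Type u} {f g : X ⟶ c.pt}
    (h : ∀ i, f ≫ proj c i = g ≫ proj c i) : f = g :=
  hc.hom_ext fun j => h j.unop

theorem exists_lift (hc : IsLimit c) {X : Type u} (t : ∀ i, X ⟶ stage B i)
    (ht : ∀ i, t (i + 1) ≫ conn B i = t i) : ∃ s : X ⟶ c.pt, ∀ i, s ≫ proj c i = t i := by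
  let d : Cone (finalSequence B) :=
    { pt := X
      π := NatTrans.ofOpSequence t fun n => by
        rw [show (finalSequence B).map (homOfLE (Nat.le_add_right n 1)).op = conn B n from
          Functor.ofOpSequence_map_homOfLE_succ (conn B) n]
        exact (Category.id_comp _).trans (ht n).symm }
  exact ⟨hc.lift d, fun i => hc.fac d (op i)⟩

theorem connOmega_proj_succ (hc : IsLimit c) (i : ℕ) :
    connOmega hc ≫ proj c (i + 1) = B.map (proj c i) :=
  hc.fac (shiftCone c) (op (i + 1))

theorem eq_stage_zero {X : Type u} (f g : X ⟶ stage B 0) : f = g := by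
  ext x
  exact Subsingleton.elim (α := PUnit) _ _

theorem point_ext (hc : IsLimit c) {x y : c.pt} (h : ∀ i, proj c i x = proj c i y) : x = y := by
  have e : TypeCat.ofHom (fun _ : PUnit.{u + 1} => x) = TypeCat.ofHom (fun _ => y) :=
    eq_of_comp_proj_eq hc fun i => by
      ext
      exact h i
  exact congrArg (fun f : PUnit ⟶ c.pt => f PUnit.unit) e

/-- The maps to the stages induced by a coalgebra. -/
def toStage {X : Type u} (h : X ⟶ B.obj X) : ∀ i, X ⟶ stage B i
  | 0 => TypeCat.ofHom fun _ => PUnit.unit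
  | i + 1 => h ≫ B.map (toStage h i)

theorem toStage_succ_conn {X : Type u} (h : X ⟶ B.obj X) (i : ℕ) :
    toStage h (i + 1) ≫ conn B i = toStage h i := by
  induction i with
  | zero => exact eq_stage_zero _ _
  | succ i ih =>
    change (h ≫ B.map (toStage h (i + 1))) ≫ B.map (conn B i) = h ≫ B.map (toStage h i)
    rw [Category.assoc, ← B.map_comp, ih]

/-- The starting point of the iteration of `solutionStep`. For nonempty `X`, composing `g` with
`B` of a constant map `F X ⟶ X` makes `X` a coalgebra. -/
theorem exists_hom_pt (hc : IsLimit c) {F : Type u ⥤ Type u} {X : Type u}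
    (g : X ⟶ B.obj (F.obj X)) : Nonempty (X ⟶ c.pt) := by
  rcases isEmpty_or_nonempty X with hX | ⟨⟨x⟩⟩
  · exact ⟨TypeCat.ofHom fun x => hX.elim x⟩
  · obtain ⟨s, -⟩ := exists_lift hc _
      (toStage_succ_conn (g ≫ B.map (TypeCat.ofHom fun _ : F.obj X => x)))
    exact ⟨s⟩

/-! ### Polynomial functors preserve the limit of the final sequence -/

theorem bijective_connOmega (hB : IsPolynomial B) (hc : IsLimit c) :
    Function.Bijective (connOmega hc) := by
  obtain ⟨P, ⟨e⟩⟩ := hB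
  have nat {X Y : Type u} (f : X ⟶ Y) (x : B.obj X) :
      e.hom.app Y (B.map f x) = P.map f (e.hom.app X x) :=
    congrArg (fun k : B.obj X ⟶ P.Obj Y => k x) (e.hom.naturality f)
  have inv_hom (X : Type u) (x : B.obj X) : e.inv.app X (e.hom.app X x) = x :=
    congrArg (fun k : B.obj X ⟶ B.obj X => k x) (e.hom_inv_id_app X)
  have hom_inv (X : Type u) (x : P.Obj X) : e.hom.app X (e.inv.app X x) = x :=
    congrArg (fun k : P.Obj X ⟶ P.Obj X => k x) (e.inv_hom_id_app X)
  have inj (X : Type u) : Function.Injective (e.hom.app X) :=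
    Function.LeftInverse.injective (inv_hom X)
  have comp (x : B.obj c.pt) (i : ℕ) : proj c (i + 1) (connOmega hc x) = B.map (proj c i) x :=
    congrArg (fun k : B.obj c.pt ⟶ stage B (i + 1) => k x) (connOmega_proj_succ hc i)
  constructor
  · intro x y hxy
    have h (i : ℕ) : P.map (proj c i) (e.hom.app _ x) = P.map (proj c i) (e.hom.app _ y) := by
      rw [← nat, ← nat, ← comp, ← comp, hxy]
    apply inj
    generalize e.hom.app c.pt x = p at h
    generalize e.hom.app c.pt y = q at h
    obtain ⟨a, f⟩ := p
    obtain ⟨a', f'⟩ := q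
    obtain rfl : a = a' := congrArg Sigma.fst (h 0)
    have hf : f = f' := funext fun k => point_ext hc fun i =>
      congrFun (eq_of_heq (Sigma.mk.inj (h i)).2) k
    rw [hf]
  · intro z
    let w (i : ℕ) : P.Obj (stage B i) := e.hom.app (stage B i) (proj c (i + 1) z)
    have hw (i : ℕ) : P.map (conn B i) (w (i + 1)) = w i :=
      (nat (conn B i) (proj c (i + 2) z)).symm.trans <|
        congrArg (fun k : c.pt ⟶ stage B (i + 1) => e.hom.app (stage B i) (k z))
          (proj_succ_conn c (i + 1))
    have hshape (i : ℕ) : ∃ f : P.B (w 0).1 → stage B i, w i = ⟨(w 0).1, f⟩ := by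
      have : (w i).1 = (w 0).1 := by
        induction i with
        | zero => rfl
        | succ i ih => rw [← ih, ← hw i, PFunctor.fst_map]
      generalize w i = p at this
      obtain ⟨a, f⟩ := p
      subst this
      exact ⟨f, rfl⟩
    choose f hf using hshape
    obtain ⟨s, hs⟩ := exists_lift hc (fun i => TypeCat.ofHom (f i)) fun i => by
      have h := hw i
      rw [hf i, hf (i + 1)] at h
      ext k
      exact congrFun (eq_of_heq (Sigma.mk.inj h).2) k
    refine ⟨e.inv.app c.pt ⟨(w 0).1, s⟩, point_ext hc fun i => ?_⟩
    cases i with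
    | zero => exact Subsingleton.elim (α := PUnit) _ _
    | succ i =>
      rw [comp]
      apply inj
      refine (nat _ _).trans <| (congrArg (P.map (proj c i)) (hom_inv _ _)).trans <|
        Eq.trans ?_ (hf i).symm
      exact congrArg (Sigma.mk _)
        (congrArg (fun k : P.B (w 0).1 ⟶ stage B i => (k : P.B (w 0).1 → stage B i)) (hs i))

/-! ### Contractivity of causal equations -/

variable {F : Type u ⥤ Type u} {α : F.obj c.pt ⟶ c.pt} {X : Type u}

/-- The operator on maps `X ⟶ B_ω` whose fixed points are the solutions of the equation given by
`g`. -/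
def solutionStep (hc : IsLimit c) (α : F.obj c.pt ⟶ c.pt) (g : X ⟶ B.obj (F.obj X))
    (s : X ⟶ c.pt) : X ⟶ c.pt :=
  g ≫ B.map (F.map s ≫ α) ≫ connOmega hc

theorem solutionStep_proj_succ_congr (hc : IsLimit c) (hα : IsCausalAlgebra c F α)
    (g : X ⟶ B.obj (F.obj X)) {s t : X ⟶ c.pt} {i : ℕ} (h : s ≫ proj c i = t ≫ proj c i) :
    solutionStep hc α g s ≫ proj c (i + 1) = solutionStep hc α g t ≫ proj c (i + 1) := by
  have key (r : X ⟶ c.pt) : solutionStep hc α g r ≫ proj c (i + 1) =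
      g ≫ B.map (F.map r ≫ α ≫ proj c i) := by
    simp only [solutionStep, Category.assoc, connOmega_proj_succ, B.map_comp]
    rfl
  rw [key, key, hα X s t i h]

theorem existsUnique_solutionStep_eq (hc : IsLimit c) (hα : IsCausalAlgebra c F α)
    (g : X ⟶ B.obj (F.obj X)) : ∃! s : X ⟶ c.pt, solutionStep hc α g s = s := by
  obtain ⟨s₀⟩ := exists_hom_pt hc g
  let r (n : ℕ) : X ⟶ c.pt := (solutionStep hc α g)^[n] s₀
  have hr (n : ℕ) : r (n + 1) = solutionStep hc α g (r n) :=
    Function.iterate_succ_apply' _ _ _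
  have stable (i : ℕ) : r (i + 1) ≫ proj c i = r i ≫ proj c i := by
    induction i with
    | zero => exact eq_stage_zero _ _
    | succ i ih =>
      rw [hr (i + 1), hr i]
      exact solutionStep_proj_succ_congr hc hα g (by rwa [← hr])
  -- The limit of the iterates: at stage `i` it is the `i`-th iterate.
  obtain ⟨s, hs⟩ := exists_lift hc (fun i => r i ≫ proj c i) fun i => by
    rw [Category.assoc, proj_succ_conn, stable]
  refine ⟨s, eq_of_comp_proj_eq hc fun i => ?_, fun t ht => eq_of_comp_proj_eq hc fun i => ?_⟩
  · cases i with
    | zero => exact eq_stage_zero _ _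
    | succ i => rw [solutionStep_proj_succ_congr hc hα g (hs i), ← hr, ← hs]
  · induction i with
    | zero => exact eq_stage_zero _ _
    | succ i ih =>
      rw [← ht, solutionStep_proj_succ_congr hc hα g (ih.trans (hs i)), ← hr, ← hs]

/-- Causal algebras over an invertible `B_{ω+1,ω}` are valid for coinduction, whether or not the
functor is polynomial. -/
theorem coinductionUpToValid_of_isCausalAlgebra (hc : IsLimit c) (ζ : c.pt ≅ B.obj c.pt)
    (hζ : ζ.inv = connOmega hc) (hα : IsCausalAlgebra c F α) :
    CoinductionUpToValid (⟨c.pt, ζ.hom⟩ : Endofunctor.Coalgebra B) F α := by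
  intro X g
  have h (s : X ⟶ c.pt) :
      s ≫ ζ.hom = g ≫ B.map (F.map s) ≫ B.map α ↔ solutionStep hc α g s = s := by
    rw [← Iso.eq_comp_inv, hζ, eq_comm]
    simp only [solutionStep, Category.assoc, B.map_comp]
  exact (existsUnique_congr h).mpr (existsUnique_solutionStep_eq hc hα g)

end FinalSequence

/-- Coinduction up to the identity is finality. -/
theorem nonempty_isTerminal_of_coinductionUpToValid {C : Type w} [Category.{v} C] {B : C ⥤ C}
    {Z : Endofunctor.Coalgebra B} (h : CoinductionUpToValid Z (𝟭 C) (𝟙 Z.V)) :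
    Nonempty (IsTerminal Z) := by
  have h' (V : Endofunctor.Coalgebra B) : ∃! s : V.V ⟶ Z.V, V.str ≫ B.map s = s ≫ Z.str := by
    refine (existsUnique_congr fun s => ?_).mp (h V.V V.str)
    have e : B.map ((𝟭 C).map s) ≫ B.map (𝟙 Z.V) = B.map s :=
      (congrArg (B.map s ≫ ·) (B.map_id Z.V)).trans (Category.comp_id _)
    rw [e, eq_comm]
  choose s hs huniq using h'
  exact ⟨IsTerminal.ofUniqueHom (fun V => ⟨s V, hs V⟩) fun V m =>
    Endofunctor.Coalgebra.ext (huniq V m.f m.h)⟩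

end CausalUpTo

theorem mainTheorem5 (B : Type u ⥤ Type u) (hB : CausalUpTo.IsPolynomial B)
    (b : Cone (CausalUpTo.finalSequence B)) (hb : IsLimit b) :
    ∃ ζ : b.pt ≅ B.obj b.pt, ζ.inv = CausalUpTo.connOmega hb ∧
      Nonempty (IsTerminal (⟨b.pt, ζ.hom⟩ : Endofunctor.Coalgebra B)) ∧
      ∀ (F : Type u ⥤ Type u) (α : F.obj b.pt ⟶ b.pt), CausalUpTo.IsCausalAlgebra b F α →
        CausalUpTo.CoinductionUpToValid (⟨b.pt, ζ.hom⟩ : Endofunctor.Coalgebra B) F α := by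
  have := (isIso_iff_bijective _).mpr (CausalUpTo.bijective_connOmega hB hb)
  let ζ := (asIso (CausalUpTo.connOmega hb)).symm
  refine ⟨ζ, rfl, ?_, fun F α hα =>
    CausalUpTo.coinductionUpToValid_of_isCausalAlgebra hb ζ rfl hα⟩
  apply CausalUpTo.nonempty_isTerminal_of_coinductionUpToValid
  apply CausalUpTo.coinductionUpToValid_of_isCausalAlgebra hb ζ rfl
  intro X f g i h
  exact h
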